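/- Let $\mathbb S$ be a semiring (for instance $\mathbb S=\mathbb C$). Let $\mathbf{Mat}_\oplus$ be the strict symmetric monoidal category whose objects are the natural numbers, whose morphisms $m\to n$ are the $m\times n$ matrices over $\mathbb S$, composed by matrix multiplication (the composite of $A:m\to n$ followed by $B:n\to k$, written $A;B$, is $AB$), with tensor product $m\oplus n=m+n$ on objects and the block-diagonal sum on morphisms, and with the block-exchange matrices as symmetries. Let $\mathbf{Path}$ be the PROP (strict symmetric monoidal category with objects the natural numbers and tensor product $m\otimes n=m+n$) generated by morphisms $\delta:1\to 2$, $\epsilon:1\to 0$, $\mu:2\to 1$, $\eta:0\to 1$ and $r:1\to 1$ for each $r\in\mathbb S$, subject to the following equations (where $f;g$ means $f$ followed by $g$, and $\sigma:2\to2$ is the symmetry): 1. $(\mu,\eta)$ is a commutative monoid and $(\delta,\epsilon)$ is a cocommutative comonoid; 2. bialgebra laws: $\mu;\delta=(\delta\otimes\delta);(\mathrm{id}_1\otimes\sigma\otimes\mathrm{id}_1);(\mu\otimes\mu)$, $\ \mu;\epsilon=\epsilon\otimes\epsilon$, $\ \eta;\delta=\eta\otimes\eta$, $\ \eta;\epsilon=\mathrm{id}_0$;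 3. each $r\in\mathbb S$ is a bialgebra endomorphism: $r;\delta=\delta;(r\otimes r)$, $\ r;\epsilon=\epsilon$, $\ \mu;r=(r\otimes r);\mu$, $\ \eta;r=\eta$; 4. semiring structure: for all $r,s\in\mathbb S$, the composite $r;s$ equals the generator $rs$, the generator $1\in\mathbb S$ equals $\mathrm{id}_1$, the composite $\delta;(r\otimes s);\mu$ equals the generator $r+s$, and the generator $0\in\mathbb S$ equals $\epsilon;\eta$. Let $\mathcal C:\mathbf{Path}\to\mathbf{Mat}_\oplus$ be the symmetric monoidal functor which is the identity on objects and satisfies $\mathcal C(\delta)=\begin{pmatrix}1&1\end{pmatrix}$, $\mathcal C(\mu)=\begin{pmatrix}1\\1\end{pmatrix}$, $\mathcal C(r)=(r)$, while $\mathcal C(\epsilon)$ and $\mathcal C(\eta)$ are the unique $1\times0$ and $0\times1$ matrices. Then the axioms of $\mathbf{Path}$ are complete for $\mathbf{Mat}_\oplus$: two diagrams $f,g:m\to n$ built from the generators, identities and symmetries by composition and tensor product are equal in $\mathbf{Path}$ if and only if $\mathcal C(f)=\mathcal C(g)$. Moreover $\mathcal C$ is a monoidal equivalence: there are a (symmetric)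 monoidal functor $G:\mathbf{Mat}_\oplus\to\mathbf{Path}$ and monoidal natural isomorphisms $\mathrm{Id}_{\mathbf{Path}}\cong G\circ\mathcal C$ and $\mathcal C\circ G\cong \mathrm{Id}_{\mathbf{Mat}_\oplus}$. -/

import Mathlib

open CategoryTheory

universe u

namespace PathCalculus

/-! ## The category of matrices with direct sum -/

section Matrices

variable {S : Type u} [Semiring S]

/-- The direct sum (block-diagonal matrix) `A ⊕ B` of two matrices. -/
def directSum {m n p q : ℕ} (A : Matrix (Fin m) (Fin n) S) (B : Matrix (Fin p) (Fin q) S) :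
    Matrix (Fin (m + p)) (Fin (n + q)) S :=
  Matrix.reindex finSumFinEquiv finSumFinEquiv (Matrix.fromBlocks A 0 0 B)

variable (S) in
/-- The `0`-`1` matrix of a bijection. -/
def permMatrix {m n : ℕ} (e : Fin m ≃ Fin n) : Matrix (Fin m) (Fin n) S :=
  fun i j => if e i = j then 1 else 0

variable (S) in
/-- The block matrix `(0, 1; 1, 0)` which exchanges the summands `m` and `n`. -/
def swapMatrix (m n : ℕ) : Matrix (Fin (m + n)) (Fin (n + m)) S :=
  permMatrix S finAddFlip

theorem directSum_apply {m n p q : ℕ} (A : Matrix (Fin m) (Fin n) S)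
    (B : Matrix (Fin p) (Fin q) S) (i : Fin (m + p)) (j : Fin (n + q)) :
    directSum A B i j =
      if hi : i.1 < m then (if hj : j.1 < n then A ⟨i, hi⟩ ⟨j, hj⟩ else 0)
      else (if hj : j.1 < n then 0 else
        B ⟨i - m, by have := i.2; omega⟩ ⟨j - n, by have := j.2; omega⟩) := by
  induction i using Fin.addCases <;> induction j using Fin.addCases <;> simp [directSum]

theorem directSum_one (m n : ℕ) :
    directSum (1 : Matrix (Fin m) (Fin m) S) (1 : Matrix (Fin n) (Fin n) S) = 1 := by
  simp [directSum, Matrix.fromBlocks_one]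

theorem directSum_mul {m n k p q l : ℕ} (A : Matrix (Fin m) (Fin n) S)
    (A' : Matrix (Fin n) (Fin k) S) (B : Matrix (Fin p) (Fin q) S)
    (B' : Matrix (Fin q) (Fin l) S) :
    directSum A B * directSum A' B' = directSum (A * A') (B * B') := by
  simp [directSum, Matrix.submatrix_mul_equiv, Matrix.fromBlocks_multiply]

theorem permMatrix_mul {m n k : ℕ} (e : Fin m ≃ Fin n) (A : Matrix (Fin n) (Fin k) S) :
    permMatrix S e * A = A.submatrix e id := by
  ext i j
  simp [permMatrix, Matrix.mul_apply]

theorem mul_permMatrix {m n k : ℕ} (e : Fin m ≃ Fin n) (A : Matrix (Fin k) (Fin m) S) :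
    A * permMatrix S e = A.submatrix id e.symm := by
  ext i j
  simp [permMatrix, Matrix.mul_apply, ← Equiv.eq_symm_apply]

theorem permMatrix_refl (m : ℕ) : permMatrix S (Equiv.refl (Fin m)) = 1 := by
  ext i j
  by_cases h : i = j
  · subst h
    simp [permMatrix]
  · simp [permMatrix, h]

theorem permMatrix_trans {m n k : ℕ} (e : Fin m ≃ Fin n) (f : Fin n ≃ Fin k) :
    permMatrix S e * permMatrix S f = permMatrix S (e.trans f) := by
  rw [permMatrix_mul]
  rfl

theorem finAddFlip_val {m n : ℕ} (i : Fin (m + n)) :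
    (finAddFlip i : Fin (n + m)).1 = if i.1 < m then n + i.1 else i.1 - m := by
  induction i using Fin.addCases <;> simp

theorem swapMatrix_apply {m n : ℕ} (i : Fin (m + n)) (j : Fin (n + m)) :
    swapMatrix S m n i j = if (if i.1 < m then n + i.1 else i.1 - m) = j.1 then 1 else 0 := by
  simp [swapMatrix, permMatrix, Fin.ext_iff, finAddFlip_val]

theorem swapMatrix_mul_swapMatrix (m n : ℕ) : swapMatrix S m n * swapMatrix S n m = 1 := by
  rw [swapMatrix, swapMatrix, permMatrix_trans, ← permMatrix_refl]
  congr 1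
  ext i
  induction i using Fin.addCases <;> simp

theorem swapMatrix_natural {m n p q : ℕ} (A : Matrix (Fin m) (Fin n) S)
    (B : Matrix (Fin p) (Fin q) S) :
    directSum A B * swapMatrix S n q = swapMatrix S m p * directSum B A := by
  rw [swapMatrix, swapMatrix, mul_permMatrix, permMatrix_mul]
  have h : (finAddFlip : Fin (n + q) ≃ Fin (q + n)).symm = finAddFlip := rfl
  ext i j
  induction i using Fin.addCases <;> induction j using Fin.addCases <;> simp [directSum, h]

theorem directSum_assoc {m n p q k l : ℕ} (A : Matrix (Fin m) (Fin n) S)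
    (B : Matrix (Fin p) (Fin q) S) (C : Matrix (Fin k) (Fin l) S) :
    directSum (directSum A B) C * permMatrix S (finCongr (Nat.add_assoc n q l)) =
      permMatrix S (finCongr (Nat.add_assoc m p k)) * directSum A (directSum B C) := by
  rw [mul_permMatrix, permMatrix_mul]
  ext i j
  simp only [Matrix.submatrix_apply, directSum_apply, finCongr_symm, finCongr_apply, id,
    Fin.val_cast]
  have := i.2
  have := j.2
  split_ifs <;> first | rfl | omega | (congr 2 <;> omega)

theorem zero_directSum {m n : ℕ} (A : Matrix (Fin m) (Fin n) S) :
    directSum (1 : Matrix (Fin 0) (Fin 0) S) A * permMatrix S (finCongr (Nat.zero_add n)) =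
      permMatrix S (finCongr (Nat.zero_add m)) * A := by
  rw [mul_permMatrix, permMatrix_mul]
  ext i j
  simp [directSum_apply]
  rfl

theorem directSum_zero {m n : ℕ} (A : Matrix (Fin m) (Fin n) S) :
    directSum A (1 : Matrix (Fin 0) (Fin 0) S) * permMatrix S (finCongr (Nat.add_zero n)) =
      permMatrix S (finCongr (Nat.add_zero m)) * A := by
  rw [mul_permMatrix, permMatrix_mul]
  ext i j
  simp [directSum_apply]

theorem directSum_perm_one {m n : ℕ} (h : m = n) (k : ℕ) :
    directSum (permMatrix S (finCongr h)) (1 : Matrix (Fin k) (Fin k) S) =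
      permMatrix S (finCongr (congrArg (· + k) h)) := by
  subst h
  simp [permMatrix_refl, directSum_one]

theorem directSum_one_perm {m n : ℕ} (h : m = n) (k : ℕ) :
    directSum (1 : Matrix (Fin k) (Fin k) S) (permMatrix S (finCongr h)) =
      permMatrix S (finCongr (congrArg (k + ·) h)) := by
  subst h
  simp [permMatrix_refl, directSum_one]

theorem permMatrix_finCongr_trans {m n k : ℕ} (h : m = n) (h' : n = k) :
    permMatrix S (finCongr h) * permMatrix S (finCongr h') =
      permMatrix S (finCongr (h.trans h')) := by
  rw [permMatrix_trans]
  rfl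

theorem permMatrix_pentagon (m n k l : ℕ) :
    directSum (permMatrix S (finCongr (Nat.add_assoc m n k))) (1 : Matrix (Fin l) (Fin l) S) *
        (permMatrix S (finCongr (Nat.add_assoc m (n + k) l)) *
          directSum (1 : Matrix (Fin m) (Fin m) S)
            (permMatrix S (finCongr (Nat.add_assoc n k l)))) =
      permMatrix S (finCongr (Nat.add_assoc (m + n) k l)) *
        permMatrix S (finCongr (Nat.add_assoc m n (k + l))) := by
  rw [directSum_perm_one, directSum_one_perm]
  simp only [permMatrix_finCongr_trans]

theorem permMatrix_triangle (m n : ℕ) :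
    permMatrix S (finCongr (Nat.add_assoc m 0 n)) *
        directSum (1 : Matrix (Fin m) (Fin m) S) (permMatrix S (finCongr (Nat.zero_add n))) =
      directSum (permMatrix S (finCongr (Nat.add_zero m))) (1 : Matrix (Fin n) (Fin n) S) := by
  rw [directSum_perm_one, directSum_one_perm, permMatrix_finCongr_trans]

theorem directSum_swap_one (m n k : ℕ) :
    directSum (swapMatrix S m n) (1 : Matrix (Fin k) (Fin k) S) =
      permMatrix S ((finSumFinEquiv.symm.trans
        (Equiv.sumCongr finAddFlip (Equiv.refl _))).trans finSumFinEquiv) := by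
  ext i j
  induction i using Fin.addCases <;> induction j using Fin.addCases <;>
    simp [directSum, permMatrix, swapMatrix, Matrix.one_apply, Fin.ext_iff]
  all_goals omega

theorem directSum_one_swap (m n k : ℕ) :
    directSum (1 : Matrix (Fin k) (Fin k) S) (swapMatrix S m n) =
      permMatrix S ((finSumFinEquiv.symm.trans
        (Equiv.sumCongr (Equiv.refl _) finAddFlip)).trans finSumFinEquiv) := by
  ext i j
  induction i using Fin.addCases <;> induction j using Fin.addCases <;>
    simp [directSum, permMatrix, swapMatrix, Matrix.one_apply, Fin.ext_iff]
  all_goals omega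

theorem sumPerm_left_val {m n k : ℕ} (i : Fin (m + n + k)) :
    (((finSumFinEquiv.symm.trans (Equiv.sumCongr finAddFlip (Equiv.refl _))).trans
        finSumFinEquiv) i : Fin (n + m + k)).1 =
      if i.1 < m then n + i.1 else if i.1 < m + n then i.1 - m else i.1 := by
  induction i using Fin.addCases with
  | left i =>
    induction i using Fin.addCases <;> simp
  | right i =>
    have h : ¬ m + n + i.1 < m := by omega
    simp [h]
    omega

theorem sumPerm_right_val {m n k : ℕ} (i : Fin (k + (m + n))) :
    (((finSumFinEquiv.symm.trans (Equiv.sumCongr (Equiv.refl _) finAddFlip)).trans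
        finSumFinEquiv) i : Fin (k + (n + m))).1 =
      if i.1 < k then i.1 else if i.1 < k + m then i.1 + n else i.1 - m := by
  induction i using Fin.addCases with
  | left i => simp
  | right i =>
    induction i using Fin.addCases <;> simp <;> omega

theorem swapMatrix_hexagon (m n k : ℕ) :
    permMatrix S (finCongr (Nat.add_assoc m n k)) *
        (swapMatrix S m (n + k) * permMatrix S (finCongr (Nat.add_assoc n k m))) =
      directSum (swapMatrix S m n) (1 : Matrix (Fin k) (Fin k) S) *
        (permMatrix S (finCongr (Nat.add_assoc n m k)) * directSum (1 : Matrix (Fin n) (Fin n) S) (swapMatrix S m k)) := by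
  rw [directSum_swap_one, directSum_one_swap, swapMatrix]
  simp only [permMatrix_trans]
  congr 1
  ext i
  have := i.2
  rw [Equiv.trans_apply, Equiv.trans_apply, Equiv.trans_apply, Equiv.trans_apply]
  simp only [sumPerm_left_val, sumPerm_right_val, finAddFlip_val, finCongr_apply, Fin.val_cast]
  split_ifs <;> omega

theorem swapMatrix_hexagon_reverse (m n k : ℕ) :
    permMatrix S (finCongr (Nat.add_assoc m n k).symm) *
        (swapMatrix S (m + n) k * permMatrix S (finCongr (Nat.add_assoc k m n).symm)) =
      directSum (1 : Matrix (Fin m) (Fin m) S) (swapMatrix S n k) *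
        (permMatrix S (finCongr (Nat.add_assoc m k n).symm) *
          directSum (swapMatrix S m k) (1 : Matrix (Fin n) (Fin n) S)) := by
  rw [directSum_swap_one, directSum_one_swap, swapMatrix]
  simp only [permMatrix_trans]
  congr 1
  ext i
  have := i.2
  rw [Equiv.trans_apply, Equiv.trans_apply, Equiv.trans_apply, Equiv.trans_apply]
  simp only [sumPerm_left_val, sumPerm_right_val, finAddFlip_val, finCongr_apply, Fin.val_cast]
  split_ifs <;> omega

end Matrices

variable (S : Type u)

/-- The category `Mat_⊕` over `S`: its objects are the natural numbers. -/
structure MatCat (S : Type u) where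
  /-- the underlying natural number -/
  dim : ℕ

section MatCategory

variable [Semiring S]

variable {S} in
/-- Morphisms `m ⟶ n` in `Mat_⊕` are the `m × n` matrices over `S`. -/
@[ext]
structure MatCat.Hom (X Y : MatCat S) : Type u where
  /-- the underlying matrix -/
  mat : Matrix (Fin X.dim) (Fin Y.dim) S

/-- The composite of `A` followed by `B` is the matrix product `A * B`. -/
instance : Category.{u} (MatCat S) where
  Hom := MatCat.Hom
  id _ := ⟨1⟩
  comp A B := ⟨A.mat * B.mat⟩
  id_comp A := MatCat.Hom.ext (Matrix.one_mul A.mat)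
  comp_id A := MatCat.Hom.ext (Matrix.mul_one A.mat)
  assoc A B C := MatCat.Hom.ext (Matrix.mul_assoc A.mat B.mat C.mat)

variable {S} in
/-- The isomorphism given by a bijection of index sets. -/
def MatCat.permIso {X Y : MatCat S} (e : Fin X.dim ≃ Fin Y.dim) : X ≅ Y where
  hom := ⟨permMatrix S e⟩
  inv := ⟨permMatrix S e.symm⟩
  hom_inv_id := MatCat.Hom.ext <| by
    refine (permMatrix_trans e e.symm).trans ?_
    rw [Equiv.self_trans_symm]
    exact permMatrix_refl _
  inv_hom_id := MatCat.Hom.ext <| by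
    refine (permMatrix_trans e.symm e).trans ?_
    rw [Equiv.symm_trans_self]
    exact permMatrix_refl _

/-- The tensor product is addition of natural numbers on objects and the direct sum of matrices
on morphisms; the associator and the unitors are identity matrices. -/
instance : MonoidalCategoryStruct (MatCat S) where
  tensorObj X Y := ⟨X.dim + Y.dim⟩
  tensorUnit := ⟨0⟩
  tensorHom A B := ⟨directSum A.mat B.mat⟩
  whiskerLeft X _ _ A := ⟨directSum (1 : Matrix (Fin X.dim) (Fin X.dim) S) A.mat⟩
  whiskerRight A X := ⟨directSum A.mat (1 : Matrix (Fin X.dim) (Fin X.dim) S)⟩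
  associator X Y Z := MatCat.permIso (finCongr (Nat.add_assoc X.dim Y.dim Z.dim))
  leftUnitor X := MatCat.permIso (finCongr (Nat.zero_add X.dim))
  rightUnitor X := MatCat.permIso (finCongr (Nat.add_zero X.dim))

instance : MonoidalCategory (MatCat S) :=
  MonoidalCategory.ofTensorHom
    (id_tensorHom_id := fun X Y => MatCat.Hom.ext (directSum_one X.dim Y.dim))
    (id_tensorHom := fun _ _ _ _ => rfl)
    (tensorHom_id := fun _ _ => rfl)
    (tensorHom_comp_tensorHom := fun A B A' B' =>
      MatCat.Hom.ext (directSum_mul A.mat A'.mat B.mat B'.mat))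
    (associator_naturality := fun A B C =>
      MatCat.Hom.ext (directSum_assoc A.mat B.mat C.mat))
    (leftUnitor_naturality := fun A => MatCat.Hom.ext (zero_directSum A.mat))
    (rightUnitor_naturality := fun A => MatCat.Hom.ext (directSum_zero A.mat))
    (pentagon := fun W X Y Z => MatCat.Hom.ext (permMatrix_pentagon W.dim X.dim Y.dim Z.dim))
    (triangle := fun X Y => MatCat.Hom.ext (permMatrix_triangle X.dim Y.dim))

/-- The symmetry is the block matrix exchanging the two summands. -/
instance : SymmetricCategory (MatCat S) where
  braiding X Y := MatCat.permIso (X := ⟨X.dim + Y.dim⟩) (Y := ⟨Y.dim + X.dim⟩) finAddFlip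
  braiding_naturality_right X _ _ A :=
    MatCat.Hom.ext (swapMatrix_natural (1 : Matrix (Fin X.dim) (Fin X.dim) S) A.mat)
  braiding_naturality_left A X :=
    MatCat.Hom.ext (swapMatrix_natural A.mat (1 : Matrix (Fin X.dim) (Fin X.dim) S))
  hexagon_forward X Y Z := MatCat.Hom.ext (swapMatrix_hexagon X.dim Y.dim Z.dim)
  hexagon_reverse X Y Z := MatCat.Hom.ext (swapMatrix_hexagon_reverse X.dim Y.dim Z.dim)
  symmetry X Y := MatCat.Hom.ext (swapMatrix_mul_swapMatrix X.dim Y.dim)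

end MatCategory

/-! ## The Path calculus -/

/-- Path diagrams with `m` inputs and `n` outputs: all sequential and parallel compositions of
identity wires, crossings of bundles of wires and the generators. The composite `comp f g` is
`f` followed by `g`. -/
inductive Diagram : ℕ → ℕ → Type u
  /-- `n` parallel wires -/
  | id (n : ℕ) : Diagram n n
  | comp {m n k : ℕ} : Diagram m n → Diagram n k → Diagram m k
  | tensor {m n p q : ℕ} : Diagram m n → Diagram p q → Diagram (m + p) (n + q)
  /-- the crossing of `m` wires with `n` wires; `σ` is `swap 1 1` -/
  | swap (m n : ℕ) : Diagram (m + n) (n + m)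
  /-- the comultiplication `δ` -/
  | delta : Diagram 1 2
  /-- the counit `ε` -/
  | epsilon : Diagram 1 0
  /-- the multiplication `μ` -/
  | mu : Diagram 2 1
  /-- the unit `η` -/
  | eta : Diagram 0 1
  /-- the endomorphism labelled by `r` -/
  | scalar (r : S) : Diagram 1 1

namespace Diagram

variable {S}

/-- `m` parallel wires, seen as a diagram from `m` to `n` when `m = n`. -/
def wires {m n : ℕ} (h : m = n) : Diagram S m n := h ▸ Diagram.id m

variable [Semiring S]

/-- Equality of Path diagrams: the congruence generated by the laws of a PROP (strict symmetric
monoidal category whose objects are the natural numbers, with addition as tensor product),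
the laws of a commutative and cocommutative bialgebra for `(μ, η, δ, ε)`, and the laws of
the scalar endomorphisms. -/
inductive Eqv : {m n : ℕ} → Diagram S m n → Diagram S m n → Prop
  -- congruence
  | refl {m n} (f : Diagram S m n) : Eqv f f
  | symm {m n} {f g : Diagram S m n} : Eqv f g → Eqv g f
  | trans {m n} {f g h : Diagram S m n} : Eqv f g → Eqv g h → Eqv f h
  | comp_congr {m n k} {f f' : Diagram S m n} {g g' : Diagram S n k} :
      Eqv f f' → Eqv g g' → Eqv (comp f g) (comp f' g')
  | tensor_congr {m n p q} {f f' : Diagram S m n} {g g' : Diagram S p q} :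
      Eqv f f' → Eqv g g' → Eqv (tensor f g) (tensor f' g')
  -- category
  | id_comp {m n} (f : Diagram S m n) : Eqv (comp (id m) f) f
  | comp_id {m n} (f : Diagram S m n) : Eqv (comp f (id n)) f
  | assoc {m n k l} (f : Diagram S m n) (g : Diagram S n k) (h : Diagram S k l) :
      Eqv (comp (comp f g) h) (comp f (comp g h))
  -- strict monoidal category
  | tensor_id (m n : ℕ) : Eqv (tensor (id m) (id n)) (id (m + n))
  | tensor_comp {m n k p q l} (f : Diagram S m n) (f' : Diagram S n k) (g : Diagram S p q)
      (g' : Diagram S q l) :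
      Eqv (comp (tensor f g) (tensor f' g')) (tensor (comp f f') (comp g g'))
  | tensor_assoc {m n p q k l} (f : Diagram S m n) (g : Diagram S p q) (h : Diagram S k l) :
      Eqv (comp (tensor (tensor f g) h) (wires (Nat.add_assoc n q l)))
        (comp (wires (Nat.add_assoc m p k)) (tensor f (tensor g h)))
  | zero_tensor {m n} (f : Diagram S m n) :
      Eqv (comp (tensor (id 0) f) (wires (Nat.zero_add n))) (comp (wires (Nat.zero_add m)) f)
  | tensor_zero {m n} (f : Diagram S m n) :
      Eqv (comp (tensor f (id 0)) (wires (Nat.add_zero n))) (comp (wires (Nat.add_zero m)) f)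
  -- symmetry
  | swap_natural {m n p q} (f : Diagram S m n) (g : Diagram S p q) :
      Eqv (comp (tensor f g) (swap n q)) (comp (swap m p) (tensor g f))
  | swap_swap (m n : ℕ) : Eqv (comp (swap m n) (swap n m)) (id (m + n))
  | hexagon (m n k : ℕ) :
      Eqv (comp (wires (Nat.add_assoc m n k))
          (comp (swap m (n + k)) (wires (Nat.add_assoc n k m))))
        (comp (tensor (swap m n) (id k))
          (comp (wires (Nat.add_assoc n m k)) (tensor (id n) (swap m k))))
  | hexagon_reverse (m n k : ℕ) :
      Eqv (comp (wires (Nat.add_assoc m n k).symm)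
          (comp (swap (m + n) k) (wires (Nat.add_assoc k m n).symm)))
        (comp (tensor (id m) (swap n k))
          (comp (wires (Nat.add_assoc m k n).symm) (tensor (swap m k) (id n))))
  -- commutative monoid
  | mu_assoc : Eqv (m := 3) (n := 1) (comp (tensor mu (id 1)) mu) (comp (tensor (id 1) mu) mu)
  | eta_mu : Eqv (m := 1) (n := 1) (comp (tensor eta (id 1)) mu) (id 1)
  | mu_eta : Eqv (m := 1) (n := 1) (comp (tensor (id 1) eta) mu) (id 1)
  | mu_comm : Eqv (m := 2) (n := 1) (comp (swap 1 1) mu) mu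
  -- cocommutative comonoid
  | delta_assoc : Eqv (m := 1) (n := 3) (comp delta (tensor delta (id 1)))
      (comp delta (tensor (id 1) delta))
  | epsilon_delta : Eqv (m := 1) (n := 1) (comp delta (tensor epsilon (id 1))) (id 1)
  | delta_epsilon : Eqv (m := 1) (n := 1) (comp delta (tensor (id 1) epsilon)) (id 1)
  | delta_comm : Eqv (m := 1) (n := 2) (comp delta (swap 1 1)) delta
  -- bialgebra
  | mu_delta : Eqv (m := 2) (n := 2) (comp mu delta)
      (comp (tensor delta delta)
        (comp (n := 4) (tensor (tensor (id 1) (swap 1 1)) (id 1)) (tensor mu mu)))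
  | mu_epsilon : Eqv (m := 2) (n := 0) (comp mu epsilon) (tensor epsilon epsilon)
  | eta_delta : Eqv (m := 0) (n := 2) (comp eta delta) (tensor eta eta)
  | eta_epsilon : Eqv (m := 0) (n := 0) (comp eta epsilon) (id 0)
  -- scalars are bialgebra endomorphisms
  | scalar_delta (r : S) : Eqv (m := 1) (n := 2) (comp (scalar r) delta)
      (comp delta (tensor (scalar r) (scalar r)))
  | scalar_epsilon (r : S) : Eqv (comp (scalar r) epsilon) epsilon
  | mu_scalar (r : S) : Eqv (m := 2) (n := 1) (comp mu (scalar r))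
      (comp (tensor (scalar r) (scalar r)) mu)
  | eta_scalar (r : S) : Eqv (comp eta (scalar r)) eta
  -- semiring structure of the scalars
  | scalar_one : Eqv (scalar 1) (id 1)
  | scalar_mul (r s : S) : Eqv (comp (scalar r) (scalar s)) (scalar (r * s))
  | scalar_zero : Eqv (scalar 0) (comp epsilon eta)
  | scalar_add (r s : S) : Eqv (m := 1) (n := 1)
      (comp delta (comp (tensor (scalar r) (scalar s)) mu)) (scalar (r + s))

/-- The classical interpretation of Path diagrams as matrices. -/
def toMatrix : {m n : ℕ} → Diagram S m n → Matrix (Fin m) (Fin n) S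
  | _, _, id _ => 1
  | _, _, comp f g => toMatrix f * toMatrix g
  | _, _, tensor f g => directSum (toMatrix f) (toMatrix g)
  | _, _, swap m n => swapMatrix S m n
  | _, _, delta => !![1, 1]
  | _, _, epsilon => !![;]
  | _, _, mu => !![1; 1]
  | _, _, eta => !![,]
  | _, _, scalar r => !![r]

theorem toMatrix_wires {m n : ℕ} (h : m = n) :
    (wires h : Diagram S m n).toMatrix = permMatrix S (finCongr h) := by
  subst h
  exact (permMatrix_refl m).symm

/-- Soundness of the rules for the matrix interpretation. -/
theorem Eqv.toMatrix_eq {m n : ℕ} {f g : Diagram S m n} (h : Eqv f g) :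
    f.toMatrix = g.toMatrix := by
  induction h with
  | refl f => rfl
  | symm _ ih => exact ih.symm
  | trans _ _ ih ih' => exact ih.trans ih'
  | comp_congr _ _ ih ih' => simp only [toMatrix, ih, ih']
  | tensor_congr _ _ ih ih' => simp only [toMatrix, ih, ih']
  | id_comp f => simp [toMatrix]
  | comp_id f => simp [toMatrix]
  | assoc f g h => simp [toMatrix, Matrix.mul_assoc]
  | tensor_id m n => exact directSum_one m n
  | tensor_comp f f' g g' => exact directSum_mul _ _ _ _
  | tensor_assoc f g h => simp only [toMatrix, toMatrix_wires]; exact directSum_assoc _ _ _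
  | zero_tensor f => simp only [toMatrix, toMatrix_wires]; exact zero_directSum _
  | tensor_zero f => simp only [toMatrix, toMatrix_wires]; exact directSum_zero _
  | swap_natural f g => exact swapMatrix_natural _ _
  | swap_swap m n => exact swapMatrix_mul_swapMatrix m n
  | hexagon m n k =>
    simp only [toMatrix, toMatrix_wires]; exact swapMatrix_hexagon m n k
  | hexagon_reverse m n k =>
    simp only [toMatrix, toMatrix_wires]; exact swapMatrix_hexagon_reverse m n k
  | eta_epsilon => ext i; exact i.elim0
  | eta_delta => ext i; exact i.elim0
  | eta_scalar => ext i; exact i.elim0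
  | mu_epsilon => ext i j; exact j.elim0
  | scalar_epsilon => ext i j; exact j.elim0
  | _ =>
    ext i j
    fin_cases i <;> fin_cases j <;>
      simp [toMatrix, Matrix.mul_apply, Fin.sum_univ_succ, directSum_apply, swapMatrix_apply,
        Matrix.one_apply]

variable (S) in
/-- Diagrams from `m` to `n`, up to provable equality. -/
def setoid (m n : ℕ) : Setoid (Diagram S m n) where
  r := Eqv
  iseqv := ⟨Eqv.refl, Eqv.symm, Eqv.trans⟩

theorem Eqv.wires_trans {m n k : ℕ} (h : m = n) (h' : n = k) :
    Eqv (comp (wires h) (wires h') : Diagram S m k) (wires (h.trans h')) := by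
  subst h h'
  exact Eqv.id_comp _

theorem Eqv.wires_tensor_id {m n : ℕ} (h : m = n) (k : ℕ) :
    Eqv (tensor (wires h) (id k) : Diagram S (m + k) (n + k)) (wires (congrArg (· + k) h)) := by
  subst h
  exact Eqv.tensor_id _ _

theorem Eqv.id_tensor_wires {m n : ℕ} (h : m = n) (k : ℕ) :
    Eqv (tensor (id k) (wires h) : Diagram S (k + m) (k + n)) (wires (congrArg (k + ·) h)) := by
  subst h
  exact Eqv.tensor_id _ _

end Diagram

/-- The category `Path`, the PROP of Path diagrams: its objects are the natural numbers. -/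
structure PathCat (S : Type u) where
  /-- the underlying natural number -/
  arity : ℕ

section PathCategory

variable [Semiring S]

open Diagram

variable {S} in
/-- Morphisms in `Path` are diagrams modulo the rules. -/
def PathCat.Hom (X Y : PathCat S) : Type u := Quotient (Diagram.setoid S X.arity Y.arity)

variable {S} in
/-- The morphism of `Path` represented by a diagram. -/
def PathCat.ofDiagram {X Y : PathCat S} (f : Diagram S X.arity Y.arity) : PathCat.Hom X Y :=
  Quotient.mk _ f

/-- Composition in `Path` is sequential composition of diagrams. -/
instance : Category.{u} (PathCat S) where
  Hom := PathCat.Hom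
  id X := PathCat.ofDiagram (Diagram.id X.arity)
  comp := Quotient.map₂ Diagram.comp fun _ _ h _ _ h' => Eqv.comp_congr h h'
  id_comp := by rintro X Y ⟨f⟩; exact Quotient.sound (Eqv.id_comp f)
  comp_id := by rintro X Y ⟨f⟩; exact Quotient.sound (Eqv.comp_id f)
  assoc := by rintro W X Y Z ⟨f⟩ ⟨g⟩ ⟨h⟩; exact Quotient.sound (Eqv.assoc f g h)

variable {S} in
/-- The identity morphism between objects with equal arities. -/
def PathCat.wiresIso {X Y : PathCat S} (h : X.arity = Y.arity) : X ≅ Y where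
  hom := PathCat.ofDiagram (wires h)
  inv := PathCat.ofDiagram (wires h.symm)
  hom_inv_id := Quotient.sound (Eqv.wires_trans h h.symm)
  inv_hom_id := Quotient.sound (Eqv.wires_trans h.symm h)

/-- The tensor product is addition on objects and parallel composition of diagrams; the
associator and the unitors are identities. -/
instance : MonoidalCategoryStruct (PathCat S) where
  tensorObj X Y := ⟨X.arity + Y.arity⟩
  tensorUnit := ⟨0⟩
  tensorHom := Quotient.map₂ Diagram.tensor fun _ _ h _ _ h' => Eqv.tensor_congr h h'
  whiskerLeft X _ _ := Quotient.map (Diagram.tensor (Diagram.id X.arity))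
    fun _ _ h => Eqv.tensor_congr (Eqv.refl _) h
  whiskerRight f X := Quotient.map (fun f => Diagram.tensor f (Diagram.id X.arity))
    (fun _ _ h => Eqv.tensor_congr h (Eqv.refl _)) f
  associator X Y Z := PathCat.wiresIso (Nat.add_assoc X.arity Y.arity Z.arity)
  leftUnitor X := PathCat.wiresIso (Nat.zero_add X.arity)
  rightUnitor X := PathCat.wiresIso (Nat.add_zero X.arity)

instance : MonoidalCategory (PathCat S) :=
  MonoidalCategory.ofTensorHom
    (id_tensorHom_id := fun X Y => Quotient.sound (Eqv.tensor_id X.arity Y.arity))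
    (id_tensorHom := by rintro X Y Z ⟨f⟩; rfl)
    (tensorHom_id := by rintro X Y ⟨f⟩ Z; rfl)
    (tensorHom_comp_tensorHom := by
      rintro _ _ _ _ _ _ ⟨f⟩ ⟨g⟩ ⟨f'⟩ ⟨g'⟩
      exact Quotient.sound (Eqv.tensor_comp f f' g g'))
    (associator_naturality := by
      rintro _ _ _ _ _ _ ⟨f⟩ ⟨g⟩ ⟨h⟩
      exact Quotient.sound (Eqv.tensor_assoc f g h))
    (leftUnitor_naturality := by rintro _ _ ⟨f⟩; exact Quotient.sound (Eqv.zero_tensor f))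
    (rightUnitor_naturality := by rintro _ _ ⟨f⟩; exact Quotient.sound (Eqv.tensor_zero f))
    (pentagon := fun W X Y Z => Quotient.sound <|
      (((Eqv.wires_tensor_id _ _).comp_congr
        (((Eqv.refl _).comp_congr (Eqv.id_tensor_wires _ _)).trans
          (Eqv.wires_trans _ _))).trans (Eqv.wires_trans _ _)).trans (Eqv.wires_trans _ _).symm)
    (triangle := fun X Y => Quotient.sound <|
      (((Eqv.refl _).comp_congr (Eqv.id_tensor_wires _ _)).trans (Eqv.wires_trans _ _)).trans
        (Eqv.wires_tensor_id _ _).symm)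

/-- The symmetry is the crossing of wires. -/
instance : SymmetricCategory (PathCat S) where
  braiding X Y :=
    { hom := PathCat.ofDiagram (X := ⟨X.arity + Y.arity⟩) (Y := ⟨Y.arity + X.arity⟩)
        (swap X.arity Y.arity)
      inv := PathCat.ofDiagram (X := ⟨Y.arity + X.arity⟩) (Y := ⟨X.arity + Y.arity⟩)
        (swap Y.arity X.arity)
      hom_inv_id := Quotient.sound (Eqv.swap_swap _ _)
      inv_hom_id := Quotient.sound (Eqv.swap_swap _ _) }
  braiding_naturality_right := by
    rintro X Y Z ⟨f⟩; exact Quotient.sound (Eqv.swap_natural _ f)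
  braiding_naturality_left := by
    rintro X Y ⟨f⟩ Z; exact Quotient.sound (Eqv.swap_natural f _)
  hexagon_forward X Y Z := Quotient.sound (Eqv.hexagon X.arity Y.arity Z.arity)
  hexagon_reverse X Y Z := Quotient.sound (Eqv.hexagon_reverse X.arity Y.arity Z.arity)
  symmetry X Y := Quotient.sound (Eqv.swap_swap X.arity Y.arity)

/-! ## The interpretation functor -/

/-- The functor `C : Path ⥤ Mat_⊕`; it is the identity on objects. -/
def interpretation : PathCat S ⥤ MatCat S where
  obj X := ⟨X.arity⟩
  map := Quotient.lift (fun f => ⟨f.toMatrix⟩) fun _ _ h => MatCat.Hom.ext h.toMatrix_eq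
  map_id _ := rfl
  map_comp := by rintro _ _ _ ⟨f⟩ ⟨g⟩; rfl

/-- `C` is a strict monoidal functor: its structure isomorphisms are identities. -/
def interpretationCoreMonoidal : (interpretation S).CoreMonoidal where
  εIso := Iso.refl _
  μIso X Y := Iso.refl ((interpretation S).obj (MonoidalCategoryStruct.tensorObj X Y))
  μIso_hom_natural_left := by
    rintro X Y ⟨f⟩ Z
    exact (Category.comp_id _).trans (Category.id_comp _).symm
  μIso_hom_natural_right := by
    rintro X Y Z ⟨f⟩
    exact (Category.comp_id _).trans (Category.id_comp _).symm
  associativity X Y Z := by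
    have h : (interpretation S).map (MonoidalCategoryStruct.associator X Y Z).hom =
        (MonoidalCategoryStruct.associator ((interpretation S).obj X)
          ((interpretation S).obj Y) ((interpretation S).obj Z)).hom :=
      MatCat.Hom.ext (toMatrix_wires _)
    rw [h]
    refine (congrArg (· ≫ _) (MonoidalCategory.id_whiskerRight _ _)).trans ?_
    refine Eq.trans ?_ (congrArg (_ ≫ · ≫ _) (MonoidalCategory.whiskerLeft_id _ _).symm)
    exact (Category.id_comp _).trans ((Category.id_comp _).trans
      ((congrArg (_ ≫ ·) (Category.id_comp _)).trans (Category.comp_id _)).symm)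
  left_unitality X := by
    have h : (interpretation S).map (MonoidalCategoryStruct.leftUnitor X).hom =
        (MonoidalCategoryStruct.leftUnitor ((interpretation S).obj X)).hom :=
      MatCat.Hom.ext (toMatrix_wires _)
    rw [h]
    refine Eq.trans ?_ (congrArg (· ≫ _) (MonoidalCategory.id_whiskerRight _ _).symm)
    exact ((Category.id_comp _).trans (Category.id_comp _)).symm
  right_unitality X := by
    have h : (interpretation S).map (MonoidalCategoryStruct.rightUnitor X).hom =
        (MonoidalCategoryStruct.rightUnitor ((interpretation S).obj X)).hom :=
      MatCat.Hom.ext (toMatrix_wires _)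
    rw [h]
    refine Eq.trans ?_ (congrArg (· ≫ _) (MonoidalCategory.whiskerLeft_id _ _).symm)
    exact ((Category.id_comp _).trans (Category.id_comp _)).symm

instance : (interpretation S).Monoidal := (interpretationCoreMonoidal S).toMonoidal

/-- `C` preserves the symmetry. -/
instance : (interpretation S).Braided where
  braided _ _ := (Category.id_comp _).trans (Category.comp_id _).symm

end PathCategory

end PathCalculus

/-!
The axioms of `Path` make every diagram a homomorphism of comonoids, so by Fox's theorem `Path` is
cartesian: a morphism to `n` is an `n`-tuple of morphisms to the generating object `1`. Addition and
scalars make the morphisms from `X` to `1` a right `S`-module, and postcomposing an `m`-tuple, seen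
as a row vector over this module, with a diagram `m → n` multiplies it by the matrix of the diagram.
Applied to the identity of `m`, this shows that the matrix determines the diagram up to the axioms,
and that the `n`-tuple obtained from an arbitrary matrix is represented by a diagram with that
matrix.
-/

namespace PathCalculus

open MonoidalCategory

section Comonoids

open ComonObj

variable {C : Type*} [Category* C] [MonoidalCategory C]

theorem comonObj_ext {X : C} {a b : ComonObj X} (h : @IsComonHom C _ _ X X a b (𝟙 X)) : a = b := by
  have h₁ := @IsComonHom.hom_counit _ _ _ _ _ a b (𝟙 X) h
  have h₂ := @IsComonHom.hom_comul _ _ _ _ _ a b (𝟙 X) h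
  rw [Category.id_comp] at h₁
  rw [Category.id_comp, id_tensorHom_id, Category.comp_id] at h₂
  cases a
  cases b
  cases h₁
  cases h₂
  rfl

attribute [local instance] ComonObj.instTensorUnit in
theorem isComonHom_counit (X : C) [ComonObj X] : IsComonHom ε[X] :=
  (default : Comon.mk X ⟶ Comon.trivial C).isComonHom_hom

theorem comul_tensorHom_whiskerLeft_counit {T X Y : C} [ComonObj T] [ComonObj Y] (f : T ⟶ X)
    (g : T ⟶ Y) [IsComonHom g] : (Δ[T] ≫ (f ⊗ₘ g)) ≫ X ◁ ε[Y] ≫ (ρ_ X).hom = f := by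
  rw [Category.assoc, tensorHom_comp_whiskerLeft_assoc, IsComonHom.hom_counit,
    reassoc_of% comul_counit_hom, Iso.inv_hom_id, Category.comp_id]

theorem comul_tensorHom_whiskerRight_counit {T X Y : C} [ComonObj T] [ComonObj X] (f : T ⟶ X)
    (g : T ⟶ Y) [IsComonHom f] : (Δ[T] ≫ (f ⊗ₘ g)) ≫ ε[X] ▷ Y ≫ (λ_ Y).hom = g := by
  rw [Category.assoc, tensorHom_comp_whiskerRight_assoc, IsComonHom.hom_counit,
    reassoc_of% counit_comul_hom, Iso.inv_hom_id, Category.comp_id]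

section Braided

variable [BraidedCategory C]

theorem isComonHom_associator_hom (X Y Z : C) [ComonObj X] [ComonObj Y] [ComonObj Z] :
    IsComonHom (α_ X Y Z).hom where
  hom_counit := by
    simp only [Comon.tensorObj_counit]
    monoidal
  hom_comul := by
    simp only [Comon.tensorObj_comul]
    rw [← tensorHom_comp_whiskerRight, ← tensorHom_comp_whiskerLeft, Category.assoc,
      Category.assoc, Category.assoc, tensor_associativity, associator_naturality_assoc]

attribute [local instance] ComonObj.instTensorUnit in
theorem isComonHom_leftUnitor_hom (X : C) [ComonObj X] : IsComonHom (λ_ X).hom where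
  hom_counit := by
    rw [Comon.tensorObj_counit, instTensorUnit_counit, id_tensorHom, leftUnitor_naturality]
  hom_comul := by
    rw [Comon.tensorObj_comul, instTensorUnit_comul, MonoidalCategory.tensorHom_def',
      Category.assoc, Category.assoc, ← tensor_left_unitality, leftUnitor_naturality]

attribute [local instance] ComonObj.instTensorUnit in
theorem isComonHom_rightUnitor_hom (X : C) [ComonObj X] : IsComonHom (ρ_ X).hom where
  hom_counit := by
    rw [Comon.tensorObj_counit, instTensorUnit_counit, tensorHom_id, unitors_equal,
      rightUnitor_naturality]
  hom_comul := by
    rw [Comon.tensorObj_comul, instTensorUnit_comul, MonoidalCategory.tensorHom_def, Category.assoc,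
      Category.assoc, ← tensor_right_unitality, rightUnitor_naturality]

theorem isComonHom_tensorHom {W X Y Z : C} [ComonObj W] [ComonObj X] [ComonObj Y] [ComonObj Z]
    (f : W ⟶ X) (g : Y ⟶ Z) [IsComonHom f] [IsComonHom g] : IsComonHom (f ⊗ₘ g) where
  hom_counit := by
    simp only [Comon.tensorObj_counit, tensorHom_comp_tensorHom_assoc, IsComonHom.hom_counit]
  hom_comul := by
    simp only [Comon.tensorObj_comul, tensorHom_comp_tensorHom_assoc, IsComonHom.hom_comul]
    rw [← tensorHom_comp_tensorHom_assoc, tensorμ_natural, Category.assoc]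

theorem comul_tensorHom_comul_tensorμ (X : C) [ComonObj X] [IsCommComonObj X] :
    Δ[X] ≫ (Δ[X] ⊗ₘ Δ[X]) ≫ tensorμ X X X X = Δ[X] ≫ (Δ[X] ⊗ₘ Δ[X]) := by
  have h : Δ[X] ≫ (Δ[X] ⊗ₘ Δ[X]) ≫ (α_ X X (X ⊗ X)).hom ≫ X ◁ (α_ X X X).inv =
      Δ[X] ≫ X ◁ (Δ[X] ≫ Δ[X] ▷ X) := by
    rw [MonoidalCategory.tensorHom_def, Category.assoc, associator_naturality_right_assoc,
      ← comul_assoc_assoc, comul_assoc_flip]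
    simp only [MonoidalCategory.whiskerLeft_comp]
  rw [tensorμ, reassoc_of% h, ← MonoidalCategory.whiskerLeft_comp_assoc, Category.assoc,
    ← comp_whiskerRight, IsCommComonObj.comul_comm, ← reassoc_of% h]
  simp

theorem isComonHom_comul (X : C) [ComonObj X] [IsCommComonObj X] : IsComonHom Δ[X] where
  hom_counit := by
    rw [Comon.tensorObj_counit, reassoc_of% counit_comul_hom, Iso.inv_hom_id, Category.comp_id]
  hom_comul := by rw [Comon.tensorObj_comul, comul_tensorHom_comul_tensorμ]

theorem comul_tensorHom_counit_counit (X Y : C) [ComonObj X] [ComonObj Y] :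
    Δ[X ⊗ Y] ≫ ((X ◁ ε[Y] ≫ (ρ_ X).hom) ⊗ₘ (ε[X] ▷ Y ≫ (λ_ Y).hom)) = 𝟙 (X ⊗ Y) := by
  have tensorμ_unit : tensorμ X (𝟙_ C) (𝟙_ C) Y ≫ ((ρ_ X).hom ⊗ₘ (λ_ Y).hom) =
      (ρ_ X).hom ⊗ₘ (λ_ Y).hom := by
    rw [tensorμ, braiding_tensorUnit_left]
    monoidal
  calc Δ[X ⊗ Y] ≫ ((X ◁ ε[Y] ≫ (ρ_ X).hom) ⊗ₘ (ε[X] ▷ Y ≫ (λ_ Y).hom))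
    _ = (Δ[X] ⊗ₘ Δ[Y]) ≫ tensorμ X X Y Y ≫
          ((𝟙 X ⊗ₘ ε[Y]) ⊗ₘ (ε[X] ⊗ₘ 𝟙 Y)) ≫ ((ρ_ X).hom ⊗ₘ (λ_ Y).hom) := by
      rw [Comon.tensorObj_comul, id_tensorHom, tensorHom_id, tensorHom_comp_tensorHom,
        Category.assoc]
    _ = (Δ[X] ⊗ₘ Δ[Y]) ≫ ((𝟙 X ⊗ₘ ε[X]) ⊗ₘ (ε[Y] ⊗ₘ 𝟙 Y)) ≫ ((ρ_ X).hom ⊗ₘ (λ_ Y).hom) := by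
      rw [← tensorμ_natural_assoc, tensorμ_unit]
    _ = 𝟙 (X ⊗ Y) := by
      simp only [tensorHom_comp_tensorHom, id_tensorHom, tensorHom_id, comul_counit_assoc,
        counit_comul_assoc, Iso.inv_hom_id, id_whiskerRight]

end Braided

theorem tensorμ_braiding [SymmetricCategory C] (W X Y Z : C) :
    tensorμ W X Y Z ≫ ((β_ W Y).hom ⊗ₘ (β_ X Z).hom) =
      (β_ (W ⊗ X) (Y ⊗ Z)).hom ≫ tensorμ Y Z W X := by
  simp only [tensorμ, Category.assoc, BraidedCategory.braiding_tensor_right_hom,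
    BraidedCategory.braiding_tensor_left_hom, comp_whiskerRight, whisker_assoc,
    MonoidalCategory.whiskerLeft_comp, pentagon_assoc, pentagon_inv_hom_hom_hom_inv_assoc,
    Iso.inv_hom_id_assoc, whiskerLeft_hom_inv_assoc]
  slice_rhs 11 12 =>
    rw [← MonoidalCategory.whiskerLeft_comp, ← comp_whiskerRight, SymmetricCategory.symmetry]
  rw [MonoidalCategory.tensorHom_def]
  monoidal

theorem isComonHom_braiding_hom [SymmetricCategory C] (X Y : C) [ComonObj X] [ComonObj Y] :
    IsComonHom (β_ X Y).hom where
  hom_counit := by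
    rw [Comon.tensorObj_counit, Comon.tensorObj_counit,
      ← BraidedCategory.braiding_naturality_assoc, braiding_leftUnitor, unitors_equal]
  hom_comul := by
    rw [Comon.tensorObj_comul, Comon.tensorObj_comul, Category.assoc, tensorμ_braiding,
      BraidedCategory.braiding_naturality_assoc]

end Comonoids

section Fox

open ComonObj CopyDiscardCategory Limits

variable {C : Type*} [Category* C] [MonoidalCategory C] [CopyDiscardCategory C]

theorem eq_comul_tensorHom {T X Y : C} (m : T ⟶ X ⊗ Y) [Deterministic m] :
    m = Δ[T] ≫ ((m ≫ X ◁ ε[Y] ≫ (ρ_ X).hom) ⊗ₘ (m ≫ ε[X] ▷ Y ≫ (λ_ Y).hom)) := by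
  rw [← tensorHom_comp_tensorHom, ← reassoc_of% (Deterministic.copy_natural m), copy_tensor,
    ← Comon.tensorObj_comul, comul_tensorHom_counit_counit, Category.comp_id]

/-- Fox's theorem: a copy-discard category in which every morphism is deterministic is cartesian
monoidal. -/
abbrev cartesianOfDeterministic (h : ∀ {X Y : C} (f : X ⟶ Y), Deterministic f) :
    CartesianMonoidalCategory C where
  isTerminalTensorUnit := IsTerminal.ofUniqueHom (fun X => ε[X]) fun X f => by
    have := h f
    rw [← Deterministic.discard_natural f, discard_unit, Category.comp_id]
  fst X Y := X ◁ ε[Y] ≫ (ρ_ X).hom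
  snd X Y := ε[X] ▷ Y ≫ (λ_ Y).hom
  fst_def _ _ := rfl
  snd_def _ _ := rfl
  tensorProductIsBinaryProduct X Y := BinaryFan.isLimitMk
    (fun s => Δ[s.pt] ≫ (s.fst ⊗ₘ s.snd))
    (fun s => have := h s.snd; comul_tensorHom_whiskerLeft_counit s.fst s.snd)
    (fun s => have := h s.fst; comul_tensorHom_whiskerRight_counit s.fst s.snd)
    (fun s m h₁ h₂ => by
      have := h m
      rw [← h₁, ← h₂]
      exact eq_comul_tensorHom m)

end Fox

section Equivalence

open Functor.LaxMonoidal Functor.OplaxMonoidal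

variable {C D : Type*} [Category* C] [Category* D] [MonoidalCategory C] [MonoidalCategory D]
  [BraidedCategory C] [BraidedCategory D]

/-- The braiding compatibility of the inverse of a braided monoidal equivalence. -/
@[reducible]
def inverseBraided (e : C ≌ D) [e.functor.Braided] [e.inverse.Monoidal] [e.IsMonoidal] :
    e.inverse.Braided where
  braided X Y := e.functor.map_injective <| by
    have h := e.counit.naturality (β_ X Y).hom
    dsimp only [Functor.comp_map, Functor.id_map, Functor.comp_obj, Functor.id_obj] at h
    rw [← cancel_mono (e.counit.app (Y ⊗ X)), Functor.map_comp, Functor.map_comp,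
      Category.assoc, Category.assoc, h, e.functor_map_μ_inverse_comp_counit_app_tensor_assoc,
      e.functor_map_μ_inverse_comp_counit_app_tensor, Functor.map_braiding,
      BraidedCategory.braiding_naturality, Category.assoc, Category.assoc,
      Functor.Monoidal.μ_δ_assoc]

theorem exists_braided_inverse (F : C ⥤ D) [F.Braided] [F.IsEquivalence] :
    ∃ (G : D ⥤ C) (_ : G.Braided) (φ : 𝟭 C ≅ F ⋙ G) (ψ : G ⋙ F ≅ 𝟭 D),
      NatTrans.IsMonoidal φ.hom ∧ NatTrans.IsMonoidal ψ.hom := by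
  let e := F.asEquivalence
  let : e.functor.Braided := ‹F.Braided›
  let : e.inverse.Monoidal := e.inverseMonoidal
  have : e.IsMonoidal :=
    letI := e.toAdjunction.rightAdjointLaxMonoidal
    inferInstanceAs e.toAdjunction.IsMonoidal
  have unit_isMonoidal : NatTrans.IsMonoidal e.unit := inferInstance
  have counit_isMonoidal : NatTrans.IsMonoidal e.counit := inferInstance
  exact ⟨e.inverse, inverseBraided e, e.unitIso, e.counitIso, unit_isMonoidal, counit_isMonoidal⟩

end Equivalence

section RowVectors

open scoped RightActions

variable {S M ι κ : Type*} [Semiring S] [AddCommMonoid M] [Module Sᵐᵒᵖ M] [Fintype ι]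

/-- The product `v A` of a row of elements of a right `S`-module with a matrix over `S`; this is
`Matrix.vecMul` when the module is `S`. -/
def vecMul (v : ι → M) (A : Matrix ι κ S) : κ → M := fun j => ∑ i, v i <• A i j

theorem vecMul_one [DecidableEq ι] (v : ι → M) : vecMul v (1 : Matrix ι ι S) = v := by
  ext j
  simp [vecMul, Matrix.one_apply, apply_ite MulOpposite.op, ite_smul]

theorem vecMul_mul [Fintype κ] {l : Type*} (v : ι → M) (A : Matrix ι κ S) (B : Matrix κ l S) :
    vecMul v (A * B) = vecMul (vecMul v A) B := by
  ext k
  simp only [vecMul, Matrix.mul_apply, Finset.op_sum, MulOpposite.op_mul, Finset.sum_smul,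
    Finset.smul_sum, mul_smul]
  exact Finset.sum_comm

theorem vecMul_comp_linearMap {N : Type*} [AddCommMonoid N] [Module Sᵐᵒᵖ N] (f : M →ₗ[Sᵐᵒᵖ] N)
    (v : ι → M) (A : Matrix ι κ S) : f ∘ vecMul v A = vecMul (f ∘ v) A := by
  ext j
  simp [vecMul]

theorem vecMul_permMatrix {m n : ℕ} (v : Fin m → M) (e : Fin m ≃ Fin n) :
    vecMul v (permMatrix S e) = v ∘ e.symm := by
  ext j
  simp [vecMul, permMatrix, apply_ite MulOpposite.op, ite_smul, ← Equiv.eq_symm_apply]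

theorem vecMul_append_directSum {m n p q : ℕ} (v : Fin m → M) (w : Fin p → M)
    (A : Matrix (Fin m) (Fin n) S) (B : Matrix (Fin p) (Fin q) S) :
    vecMul (Fin.append v w) (directSum A B) = Fin.append (vecMul v A) (vecMul w B) := by
  ext j
  induction j using Fin.addCases <;> simp [vecMul, Fin.sum_univ_add, directSum]

theorem vecMul_append_swapMatrix {m n : ℕ} (v : Fin m → M) (w : Fin n → M) :
    vecMul (Fin.append v w) (swapMatrix S m n) = Fin.append w v := by
  rw [swapMatrix, vecMul_permMatrix, ← Equiv.eq_comp_symm]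
  ext j
  induction j using Fin.addCases <;> simp

end RowVectors

/-- The morphism of `Path` represented by a diagram, as an arrow between the numbers of its inputs
and outputs. -/
def Diagram.toHom {S : Type u} [Semiring S] {m n : ℕ} (f : Diagram S m n) :
    (⟨m⟩ : PathCat S) ⟶ ⟨n⟩ :=
  PathCat.ofDiagram f

namespace PathCat

open ComonObj Diagram

variable {S : Type u} [Semiring S]

variable (S) in
/-- The generating object `1` of `Path`. -/
def wire : PathCat S := ⟨1⟩

variable (S) in
/-- The generator `δ`. -/
def copy : wire S ⟶ wire S ⊗ wire S := delta.toHom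

variable (S) in
/-- The generator `ε`. -/
def discard : wire S ⟶ 𝟙_ (PathCat S) := epsilon.toHom

variable (S) in
/-- The generator `μ`. -/
def add : wire S ⊗ wire S ⟶ wire S := mu.toHom

variable (S) in
/-- The generator `η`. -/
def zero : 𝟙_ (PathCat S) ⟶ wire S := eta.toHom

/-- The generator labelled by `r`. -/
def scale (r : S) : wire S ⟶ wire S := (scalar r).toHom

section Comonoid

/-- The comonoid structure `(δ, ε)` on the generating object. It is only a local instance:
`Path` as a whole is a copy-discard category. -/
@[reducible]
def wireComonObj : ComonObj (wire S) where
  counit := discard S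
  comul := copy S
  counit_comul := Quotient.sound Eqv.epsilon_delta
  comul_counit := Quotient.sound Eqv.delta_epsilon
  comul_assoc := (Quotient.sound Eqv.delta_assoc.symm).trans
    (congrArg (copy S ≫ ·) (Category.comp_id (copy S ▷ wire S)).symm)

attribute [local instance] ComonObj.instTensorUnit wireComonObj

/-- The comonoid structure on `n` parallel copies of the generating object. -/
@[reducible]
def comonObj : ∀ n : ℕ, ComonObj (⟨n⟩ : PathCat S)
  | 0 => inferInstanceAs (ComonObj (𝟙_ (PathCat S)))
  | n + 1 =>
    letI := comonObj n
    inferInstanceAs (ComonObj ((⟨n⟩ : PathCat S) ⊗ wire S))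

attribute [local instance] comonObj

instance isCommComonObj_wire : IsCommComonObj (wire S) where
  comul_comm := Quotient.sound Eqv.delta_comm

theorem isCommComonObj : ∀ n : ℕ, IsCommComonObj (⟨n⟩ : PathCat S)
  | 0 => inferInstanceAs (IsCommComonObj (𝟙_ (PathCat S)))
  | n + 1 =>
    have : IsCommComonObj (⟨n⟩ : PathCat S) := isCommComonObj n
    inferInstanceAs (IsCommComonObj ((⟨n⟩ : PathCat S) ⊗ wire S))

-- `Path` is strict: its coherence isomorphisms unfold to identities, so steps that only move them
-- around are closed by unfolding instead of by rewriting with the coherence lemmas.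
theorem comonObj_one : comonObj 1 = wireComonObj (S := S) :=
  comonObj_ext (isComonHom_leftUnitor_hom (wire S))

theorem comonObj_add (m : ℕ) : ∀ n : ℕ,
    comonObj (m + n) = Comon.instComonObjTensorObj (⟨m⟩ : PathCat S) ⟨n⟩
  | 0 => (comonObj_ext (isComonHom_rightUnitor_hom (⟨m⟩ : PathCat S))).symm
  | n + 1 => by
    have h := isComonHom_associator_hom (⟨m⟩ : PathCat S) ⟨n⟩ (wire S)
    rw [← comonObj_add m n] at h
    exact comonObj_ext h

instance : CopyDiscardCategory (PathCat S) where
  comonObj X := comonObj X.arity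
  isCommComonObj X := isCommComonObj X.arity
  copy_tensor X Y := (congrArg (@comul _ _ _ _) (comonObj_add X.arity Y.arity)).trans
    (Comon.tensorObj_comul (⟨X.arity⟩ : PathCat S) ⟨Y.arity⟩)
  discard_tensor X Y := (congrArg (@counit _ _ _ _) (comonObj_add X.arity Y.arity)).trans
    (Comon.tensorObj_counit (⟨X.arity⟩ : PathCat S) ⟨Y.arity⟩)
  copy_unit := rfl
  discard_unit := rfl

theorem tensorμ_wire : tensorμ (wire S) (wire S) (wire S) (wire S) =
    (wire S ◁ (β_ (wire S) (wire S)).hom) ▷ wire S := by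
  have assoc_whiskers : (wire S ◁ (β_ (wire S) (wire S)).hom) ▷ wire S =
      wire S ◁ ((β_ (wire S) (wire S)).hom ▷ wire S) :=
    (whisker_assoc (wire S) (β_ (wire S) (wire S)).hom (wire S)).trans
      ((Category.id_comp _).trans (Category.comp_id _))
  rw [assoc_whiskers]
  have whiskerLeft_inv : wire S ◁ (α_ (wire S) (wire S) (wire S)).inv = 𝟙 _ :=
    MonoidalCategory.whiskerLeft_id (wire S) (wire S ⊗ wire S ⊗ wire S)
  have whiskerLeft_hom : wire S ◁ (α_ (wire S) (wire S) (wire S)).hom = 𝟙 _ :=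
    MonoidalCategory.whiskerLeft_id (wire S) (wire S ⊗ wire S ⊗ wire S)
  rw [tensorμ, whiskerLeft_inv, whiskerLeft_hom]
  exact (Category.id_comp _).trans <| (Category.id_comp _).trans <|
    (congrArg (_ ≫ ·) (Category.id_comp _)).trans (Category.comp_id _)

theorem isComonHom_add : IsComonHom (add S) where
  hom_counit := by
    rw [Comon.tensorObj_counit]
    exact (Quotient.sound Eqv.mu_epsilon).trans
      (Category.comp_id (ε[wire S] ⊗ₘ ε[wire S])).symm
  hom_comul := by
    rw [Comon.tensorObj_comul, Category.assoc, tensorμ_wire]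
    exact Quotient.sound Eqv.mu_delta

theorem isComonHom_zero : IsComonHom (zero S) where
  hom_counit := Quotient.sound Eqv.eta_epsilon
  hom_comul := (Quotient.sound Eqv.eta_delta).trans (Category.id_comp (zero S ⊗ₘ zero S)).symm

theorem isComonHom_scale (r : S) : IsComonHom (scale r) where
  hom_counit := Quotient.sound (Eqv.scalar_epsilon r)
  hom_comul := Quotient.sound (Eqv.scalar_delta r)

theorem isComonHom_toHom {m n : ℕ} (f : Diagram S m n) : IsComonHom f.toHom := by
  have comonObj_two : comonObj 2 = Comon.instComonObjTensorObj (wire S) (wire S) := by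
    rw [← comonObj_one]
    exact comonObj_add 1 1
  induction f with
  | id n => exact inferInstanceAs (IsComonHom (𝟙 (⟨n⟩ : PathCat S)))
  | comp f g hf hg => exact inferInstanceAs (IsComonHom (f.toHom ≫ g.toHom))
  | tensor f g hf hg =>
    rw [comonObj_add, comonObj_add]
    exact isComonHom_tensorHom f.toHom g.toHom
  | swap m n =>
    rw [comonObj_add, comonObj_add]
    exact isComonHom_braiding_hom (⟨m⟩ : PathCat S) ⟨n⟩
  | delta =>
    rw [comonObj_two, comonObj_one]
    exact isComonHom_comul (wire S)
  | epsilon =>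
    rw [comonObj_one]
    exact isComonHom_counit (wire S)
  | mu =>
    rw [comonObj_two, comonObj_one]
    exact isComonHom_add
  | eta =>
    rw [comonObj_one]
    exact isComonHom_zero
  | scalar r =>
    rw [comonObj_one]
    exact isComonHom_scale r

end Comonoid

instance : CartesianMonoidalCategory (PathCat S) :=
  cartesianOfDeterministic (by rintro X Y ⟨f⟩; exact isComonHom_toHom f)

open CartesianMonoidalCategory
open scoped AddMonObj MonObj

instance : AddMonObj (wire S) where
  zero := zero S
  add := add S
  zero_add := Quotient.sound Eqv.eta_mu
  add_zero := Quotient.sound Eqv.mu_eta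
  add_assoc := (Quotient.sound Eqv.mu_assoc).trans
    (Category.id_comp (wire S ◁ add S ≫ add S : wire S ⊗ wire S ⊗ wire S ⟶ wire S)).symm

instance : IsCommAddMonObj (wire S) where
  add_comm := Quotient.sound Eqv.mu_comm

theorem add_comp_scale {X : PathCat S} (f g : X ⟶ wire S) (r : S) :
    (f + g) ≫ scale r = f ≫ scale r + g ≫ scale r := by
  have add_comp : add S ≫ scale r = (scale r ⊗ₘ scale r) ≫ add S :=
    Quotient.sound (Eqv.mu_scalar r)
  rw [Hom.add_def, Hom.add_def, ← lift_map_assoc, Category.assoc]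
  exact congrArg (lift f g ≫ ·) add_comp

theorem zero_comp_scale {X : PathCat S} (r : S) : (0 : X ⟶ wire S) ≫ scale r = 0 := by
  rw [Hom.zero_def, Category.assoc]
  exact congrArg (toUnit X ≫ ·) (Quotient.sound (Eqv.eta_scalar r))

theorem scale_one : scale (1 : S) = 𝟙 (wire S) := Quotient.sound Eqv.scalar_one

theorem scale_mul (r s : S) : scale (r * s) = scale r ≫ scale s :=
  (Quotient.sound (Eqv.scalar_mul r s)).symm

theorem scale_zero : scale (0 : S) = 0 := by
  rw [Hom.zero_def, toUnit_unique (toUnit _) (discard S)]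
  exact Quotient.sound Eqv.scalar_zero

theorem copy_eq_lift : copy S = lift (𝟙 (wire S)) (𝟙 (wire S)) :=
  letI := wireComonObj (S := S)
  comul_eq_lift (wire S)

theorem scale_add (r s : S) : scale (r + s) = scale r + scale s := by
  have h : copy S ≫ (scale r ⊗ₘ scale s) ≫ add S = scale (r + s) :=
    Quotient.sound (Eqv.scalar_add r s)
  rw [← h, copy_eq_lift, lift_map_assoc, Category.id_comp, Category.id_comp]
  rfl

instance (X : PathCat S) : Module Sᵐᵒᵖ (X ⟶ wire S) where
  smul r f := f ≫ scale r.unop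
  one_smul f := (congrArg (f ≫ ·) scale_one).trans (Category.comp_id f)
  mul_smul r s f := (congrArg (f ≫ ·) (scale_mul s.unop r.unop)).trans (Category.assoc ..).symm
  smul_zero r := zero_comp_scale r.unop
  smul_add r f g := add_comp_scale f g r.unop
  add_smul r s f := (congrArg (f ≫ ·) (scale_add r.unop s.unop)).trans (AddMonObj.comp_add f _ _)
  zero_smul f := (congrArg (f ≫ ·) scale_zero).trans (AddMonObj.comp_zero f)

/-- Precomposition with `f`, as a homomorphism of right `S`-modules. -/
def precomp {X Y : PathCat S} (f : X ⟶ Y) : (Y ⟶ wire S) →ₗ[Sᵐᵒᵖ] (X ⟶ wire S) where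
  toFun g := f ≫ g
  map_add' := AddMonObj.comp_add f
  map_smul' r g := (Category.assoc f g (scale r.unop)).symm

/-- A morphism to `n` is an `n`-tuple of morphisms to the generating object. -/
def components {X : PathCat S} : ∀ n : ℕ, (X ⟶ ⟨n⟩) ≃ (Fin n → (X ⟶ wire S))
  | 0 => Equiv.ofUnique (X ⟶ 𝟙_ (PathCat S)) (Fin 0 → (X ⟶ wire S))
  | n + 1 => (homEquivToProd (X := (⟨n⟩ : PathCat S)) (Y := wire S)).trans <|
      ((components n).prodCongr (Equiv.refl _)).trans <| (Equiv.prodComm _ _).trans <|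
        Fin.snocEquiv fun _ => X ⟶ wire S

theorem components_succ {X : PathCat S} {n : ℕ} (f : X ⟶ (⟨n⟩ : PathCat S) ⊗ wire S) :
    components (n + 1) f = Fin.snoc (α := fun _ => X ⟶ wire S)
      (components n (f ≫ fst (⟨n⟩ : PathCat S) (wire S))) (f ≫ snd _ _) := rfl

theorem components_comp {X Y : PathCat S} (f : X ⟶ Y) : ∀ {n : ℕ} (g : Y ⟶ ⟨n⟩),
    components n (f ≫ g) = precomp f ∘ components n g
  | 0, g => Subsingleton.elim _ _
  | n + 1, g => by
    have components_fst : components n ((f ≫ g) ≫ fst (⟨n⟩ : PathCat S) (wire S)) =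
        precomp f ∘ components n (g ≫ fst _ _) :=
      (congrArg (components n) (Category.assoc ..)).trans (components_comp f _)
    exact (congrArg₂ (Fin.snoc (α := fun _ => X ⟶ wire S)) components_fst
      (Category.assoc f g (snd ..))).trans (Fin.comp_snoc ..).symm

theorem components_one {X : PathCat S} (f : X ⟶ wire S) : components 1 f = fun _ => f := by
  ext i
  rw [Subsingleton.elim i (Fin.last 0)]
  refine (congrFun (components_succ (n := 0) f) (Fin.last 0)).trans ?_
  rw [Fin.snoc_last]
  exact (congrArg (f ≫ ·) (leftUnitor_hom (wire S)).symm).trans (Category.comp_id f)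

theorem components_append {X : PathCat S} (m : ℕ) :
    ∀ {n : ℕ} (f : X ⟶ (⟨m⟩ : PathCat S) ⊗ ⟨n⟩), components (m + n) f =
      Fin.append (components m (f ≫ fst _ _)) (components n (f ≫ snd (⟨m⟩ : PathCat S) ⟨n⟩))
  | 0, f => by
    have h : f ≫ fst (⟨m⟩ : PathCat S) (𝟙_ (PathCat S)) = f :=
      (congrArg (f ≫ ·) (rightUnitor_hom _).symm).trans (Category.comp_id f)
    rw [Subsingleton.elim (components 0 _) Fin.elim0, Fin.append_elim0]
    exact congrArg (components m) h.symm
  | n + 1, f => by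
    let Y : PathCat S := ⟨m⟩
    let Z : PathCat S := ⟨n⟩
    have fst_fst : (f ≫ fst (Y ⊗ Z) (wire S)) ≫ fst Y Z = f ≫ fst Y (Z ⊗ wire S) :=
      (Category.assoc ..).trans <| congrArg (f ≫ ·) <|
        (associator_hom_fst Y Z (wire S)).symm.trans (Category.id_comp _)
    have snd_fst : (f ≫ fst (Y ⊗ Z) (wire S)) ≫ snd Y Z =
        (f ≫ snd Y (Z ⊗ wire S)) ≫ fst Z (wire S) :=
      (Category.assoc ..).trans <| (congrArg (f ≫ ·) <|
        (associator_hom_snd_fst Y Z (wire S)).symm.trans (Category.id_comp _)).trans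
          (Category.assoc ..).symm
    have snd_snd : f ≫ snd (Y ⊗ Z) (wire S) = (f ≫ snd Y (Z ⊗ wire S)) ≫ snd Z (wire S) :=
      (congrArg (f ≫ ·) <|
        (associator_hom_snd_snd Y Z (wire S)).symm.trans (Category.id_comp _)).trans
          (Category.assoc ..).symm
    have append_fst := components_append m (f ≫ fst (Y ⊗ Z) (wire S))
    rw [fst_fst, snd_fst] at append_fst
    exact (congrArg₂ (Fin.snoc (α := fun _ => X ⟶ wire S)) append_fst snd_snd).trans
      (Fin.append_snoc ..).symm

theorem components_two {X : PathCat S} (f : X ⟶ wire S ⊗ wire S) :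
    components 2 f = ![f ≫ fst _ _, f ≫ snd _ _] := by
  refine (components_append 1 f).trans ?_
  refine (congrArg₂ Fin.append (components_one (f ≫ fst (wire S) (wire S)))
    (components_one (f ≫ snd (wire S) (wire S)))).trans ?_
  ext j
  fin_cases j <;> rfl

theorem components_comp_copy {X : PathCat S} (f : X ⟶ wire S) :
    components 2 (f ≫ copy S) = vecMul (components 1 f) !![(1 : S), 1] := by
  have h : f ≫ copy S = lift f f := by rw [copy_eq_lift, comp_lift, Category.comp_id]
  refine (congrArg (components 2) h).trans ((components_two _).trans ?_)
  rw [lift_fst, lift_snd]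
  ext j
  fin_cases j <;> simp [vecMul, components_one]

theorem components_comp_add {X : PathCat S} (f : X ⟶ wire S ⊗ wire S) :
    components 1 (f ≫ add S) = vecMul (components 2 f) !![(1 : S); 1] := by
  have h : f ≫ add S = f ≫ fst _ _ + f ≫ snd _ _ := by
    rw [Hom.add_def, lift_comp_fst_snd]
    rfl
  refine (congrArg (components 1) h).trans ((components_one _).trans ?_)
  ext j
  simp [vecMul, components_two]

theorem components_comp_zero {X : PathCat S} (f : X ⟶ 𝟙_ (PathCat S)) :
    components 1 (f ≫ zero S) = vecMul (components 0 f) (!![,] : Matrix (Fin 0) (Fin 1) S) := by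
  rw [toUnit_unique f (toUnit X)]
  refine (components_one (toUnit X ≫ zero S)).trans ?_
  ext j
  exact Finset.sum_empty.symm

theorem components_comp_scale {X : PathCat S} (f : X ⟶ wire S) (r : S) :
    components 1 (f ≫ scale r) = vecMul (components 1 f) !![r] := by
  refine (components_one _).trans ?_
  ext j
  simp only [vecMul, components_one, Fin.sum_univ_one, Subsingleton.elim j 0]
  rfl

theorem components_comp_tensorHom {X : PathCat S} {m n p q : ℕ}
    (t : X ⟶ (⟨m⟩ : PathCat S) ⊗ ⟨p⟩) {f : (⟨m⟩ : PathCat S) ⟶ ⟨n⟩} {g : (⟨p⟩ : PathCat S) ⟶ ⟨q⟩}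
    {A : Matrix (Fin m) (Fin n) S} {B : Matrix (Fin p) (Fin q) S}
    (hf : ∀ t : X ⟶ ⟨m⟩, components n (t ≫ f) = vecMul (components m t) A)
    (hg : ∀ t : X ⟶ ⟨p⟩, components q (t ≫ g) = vecMul (components p t) B) :
    components (n + q) (t ≫ (f ⊗ₘ g)) = vecMul (components (m + p) t) (directSum A B) := by
  rw [components_append, Category.assoc, Category.assoc, tensorHom_fst, tensorHom_snd,
    ← Category.assoc, ← Category.assoc, hf, hg, components_append, vecMul_append_directSum]

theorem components_comp_braiding {X : PathCat S} {m n : ℕ} (t : X ⟶ (⟨m⟩ : PathCat S) ⊗ ⟨n⟩) :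
    components (n + m) (t ≫ (β_ (⟨m⟩ : PathCat S) ⟨n⟩).hom) =
      vecMul (components (m + n) t) (swapMatrix S m n) := by
  rw [components_append, Category.assoc, Category.assoc, braiding_hom_fst, braiding_hom_snd,
    components_append, vecMul_append_swapMatrix]

theorem components_comp_toHom {X : PathCat S} {m n : ℕ} (t : X ⟶ ⟨m⟩) (f : Diagram S m n) :
    components n (t ≫ f.toHom) = vecMul (components m t) f.toMatrix := by
  induction f with
  | id n => exact (congrArg (components n) (Category.comp_id t)).trans (vecMul_one _).symm
  | comp f g hf hg =>
    refine (congrArg (components _) (Category.assoc t f.toHom g.toHom).symm).trans ?_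
    rw [hg, hf, toMatrix, vecMul_mul]
  | tensor f g hf hg => exact components_comp_tensorHom t hf hg
  | swap m n => exact components_comp_braiding t
  | delta => exact components_comp_copy t
  | epsilon => exact Subsingleton.elim _ _
  | mu => exact components_comp_add t
  | eta => exact components_comp_zero t
  | scalar r => exact components_comp_scale t r

theorem scale_injective : Function.Injective (scale (S := S)) := fun _ _ h =>
  congrFun (congrFun (Eqv.toMatrix_eq (Quotient.exact h)) 0) 0

variable (S) in
/-- The homomorphism of right `S`-modules taking `r` to the generator labelled by `r`. -/
def scaleLinear : S →ₗ[Sᵐᵒᵖ] (wire S ⟶ wire S) where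
  toFun := scale
  map_add' := scale_add
  map_smul' r s := scale_mul s r.unop

/-- The `i`-th coprojection into `m`: its components are the `i`-th row of the identity matrix. -/
def unitVector {m : ℕ} (i : Fin m) : wire S ⟶ ⟨m⟩ :=
  (components m).symm fun j => scale ((1 : Matrix (Fin m) (Fin m) S) i j)

theorem precomp_unitVector_vecMul {m n : ℕ} (A : Matrix (Fin m) (Fin n) S) (i : Fin m)
    (j : Fin n) :
    precomp (unitVector i) (vecMul (components m (𝟙 _)) A j) = scale (A i j) :=
  calc precomp (unitVector i) (vecMul (components m (𝟙 _)) A j)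
    _ = vecMul (components m (unitVector i ≫ 𝟙 _)) A j := by
      rw [components_comp, ← vecMul_comp_linearMap, Function.comp_apply]
    _ = vecMul (scaleLinear S ∘ (1 : Matrix (Fin m) (Fin m) S) i) A j := by
      rw [Category.comp_id, unitVector, Equiv.apply_symm_apply]
      rfl
    _ = scale (((1 : Matrix (Fin m) (Fin m) S) * A) i j) :=
      congrFun (vecMul_comp_linearMap (scaleLinear S) _ A).symm j
    _ = scale (A i j) := by rw [Matrix.one_mul]

theorem eqv_of_toMatrix_eq {m n : ℕ} {f g : Diagram S m n} (h : f.toMatrix = g.toMatrix) :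
    f.Eqv g := by
  have h' : components n (𝟙 (⟨m⟩ : PathCat S) ≫ f.toHom) =
      components n (𝟙 (⟨m⟩ : PathCat S) ≫ g.toHom) := by
    rw [components_comp_toHom, components_comp_toHom, h]
  rw [EmbeddingLike.apply_eq_iff_eq, Category.id_comp, Category.id_comp] at h'
  exact Quotient.exact h'

theorem exists_toMatrix_eq {m n : ℕ} (A : Matrix (Fin m) (Fin n) S) :
    ∃ f : Diagram S m n, f.toMatrix = A := by
  obtain ⟨f, hf⟩ := Quotient.exists_rep
    ((components n).symm (vecMul (components m (𝟙 (⟨m⟩ : PathCat S))) A))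
  have h : vecMul (components m (𝟙 (⟨m⟩ : PathCat S))) f.toMatrix =
      vecMul (components m (𝟙 _)) A := by
    rw [← components_comp_toHom, Category.id_comp]
    exact ((components n).symm_apply_eq.mp hf.symm).symm
  refine ⟨f, Matrix.ext fun i j => scale_injective ?_⟩
  rw [← precomp_unitVector_vecMul, h, precomp_unitVector_vecMul]

instance : (interpretation S).Faithful where
  map_injective := by
    rintro X Y ⟨f⟩ ⟨g⟩ h
    exact Quotient.sound (eqv_of_toMatrix_eq (congrArg MatCat.Hom.mat h))

instance : (interpretation S).Full where
  map_surjective A :=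
    let ⟨f, hf⟩ := exists_toMatrix_eq A.mat
    ⟨f.toHom, MatCat.Hom.ext hf⟩

instance : (interpretation S).EssSurj where
  mem_essImage Y := ⟨⟨Y.dim⟩, ⟨Iso.refl Y⟩⟩

instance : (interpretation S).IsEquivalence where

end PathCat

end PathCalculus

theorem mainTheorem3 (S : Type u) [Semiring S] :
    (∀ (m n : ℕ) (f g : PathCalculus.Diagram S m n), f.Eqv g ↔ f.toMatrix = g.toMatrix) ∧
    ∃ (G : PathCalculus.MatCat S ⥤ PathCalculus.PathCat S) (_ : G.Braided)
      (φ : 𝟭 (PathCalculus.PathCat S) ≅ PathCalculus.interpretation S ⋙ G)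
      (ψ : G ⋙ PathCalculus.interpretation S ≅ 𝟭 (PathCalculus.MatCat S)),
      NatTrans.IsMonoidal φ.hom ∧ NatTrans.IsMonoidal ψ.hom :=
  ⟨fun _ _ _ _ => ⟨PathCalculus.Diagram.Eqv.toMatrix_eq,
    PathCalculus.PathCat.eqv_of_toMatrix_eq⟩,
    PathCalculus.exists_braided_inverse (PathCalculus.interpretation S)⟩
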